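/- Let $RF=P/Q$ be a real rational function ($P,Q\in\mathbb R[s]$ coprime), regarded as a continuous map of the extended complex plane $\hat{\mathbb C}=\mathbb C\cup\{\infty\}$ to itself, so that $\infty$ may be a pole, a zero or an ordinary point of $RF$. Let $\varepsilon\in\{1,-1\}$ and consider the root locus equation $K\cdot RF(s)=\varepsilon$. Let $$\mathcal L_\varepsilon=\{s\in\hat{\mathbb C}:\ RF(s)\in\mathbb C,\ K\cdot RF(s)=\varepsilon \text{ for some real } K>0\},$$ and define the gain at $s\in\hat{\mathbb C}$ by $K(s)=|1/RF(s)|\in[0,+\infty]$, with $K=0$ at the poles and $K=+\infty$ at the zeros of $RF$. A system of root loci of the equation is a finite family of continuous curves $\gamma_1,\dots,\gamma_n:[0,1]\to\hat{\mathbb C}$ such that: each $\gamma_i(0)$ is a pole of $RF$ and each $\gamma_i(1)$ is a zero of $RF$ (either may be $\infty$); $\gamma_i(t)\in\mathcal L_\varepsilon$ for $0<t<1$; the curves together cover $\mathcal L_\varepsilon$; and the curves do not overlap, i.e. there are only finitely many pairs $(i,t)\neq(j,u)$ with $\gamma_i(t)=\gamma_j(u)\in\mathcal L_\varepsilon$ (they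 may cross at finitely many breakaway points). A branch of the root locus is a member of such a system. Theorem 2.8. Along each branch $\gamma:[0,1]\to\hat{\mathbb C}$ of the root locus of $K\cdot RF=\pm1$ the gain increases strictly monotonically from the pole to the zero: $K(\gamma(t))<K(\gamma(u))$ whenever $0\le t<u\le1$. -/

import Mathlib

open scoped ENNReal unitInterval

noncomputable section

namespace RootLocus

/-- The value of the real rational function `f` at a point of the extended complex plane
`ℂ ∪ {∞}`. Since `f.num` and `f.denom` are coprime, common zeros and poles have been removed.
At the point `∞` this is the limit of `f`. -/
def value (f : RatFunc ℝ) (z : OnePoint ℂ) : OnePoint ℂ :=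
  z.elim
    (if f.denom.natDegree < f.num.natDegree then OnePoint.infty
      else (((f.num.coeff f.denom.natDegree / f.denom.leadingCoeff : ℝ) : ℂ) : OnePoint ℂ))
    (fun s : ℂ =>
      if Polynomial.aeval s f.denom = 0 then OnePoint.infty
      else ((Polynomial.aeval s f.num / Polynomial.aeval s f.denom : ℂ) : OnePoint ℂ))

/-- Poles of `f` in the extended plane. -/
def IsPole (f : RatFunc ℝ) (z : OnePoint ℂ) : Prop := value f z = OnePoint.infty

/-- Zeros of `f` in the extended plane. -/
def IsZero (f : RatFunc ℝ) (z : OnePoint ℂ) : Prop := value f z = ((0 : ℂ) : OnePoint ℂ)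

/-- The gain `K = |1 / f|`, with value `0` at the poles and `+∞` at the zeros of `f`. -/
def gain (f : RatFunc ℝ) (z : OnePoint ℂ) : ℝ≥0∞ :=
  (value f z).elim 0 (fun w : ℂ => ‖w‖ₑ⁻¹)

/-- The points of the extended plane that satisfy the root locus equation `K * f = ε` for some
finite gain `K > 0`. For `ε = 1` these are the points where the argument of `f` is `2qπ`, for
`ε = -1` those where it is `2qπ + π`. -/
def locus (f : RatFunc ℝ) (ε : ℝ) : Set (OnePoint ℂ) :=
  {z | ∃ K : ℝ, 0 < K ∧ ∃ w : ℂ, value f z = (w : OnePoint ℂ) ∧ (K : ℂ) * w = (ε : ℂ)}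

/-- A family of curves in the extended plane that is a system of root loci (branches) of
`K * f = ε`: every curve begins at a pole, runs through points satisfying the equation, and ends
at a zero; together the curves fill the set of all such points; and they do not overlap, that is,
apart from finitely many crossings no point is traced twice (by two curves, or by one curve at two
times). The curves need not be parametrized by the gain, and nothing is prescribed about
the gain along a curve, about the number of curves, or about how they continue at a crossing. -/
structure IsSystem (f : RatFunc ℝ) (ε : ℝ) {n : ℕ} (Γ : Fin n → C(I, OnePoint ℂ)) : Prop where
  start_pole : ∀ i, IsPole f (Γ i 0)
  end_zero : ∀ i, IsZero f (Γ i 1)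
  mem_locus : ∀ i t, 0 < t → t < 1 → Γ i t ∈ locus f ε
  covers : ∀ z ∈ locus f ε, ∃ i t, Γ i t = z
  no_overlap : {x : (Fin n × I) × (Fin n × I) |
    x.1 ≠ x.2 ∧ Γ x.1.1 x.1.2 = Γ x.2.1 x.2.2 ∧ Γ x.1.1 x.1.2 ∈ locus f ε}.Finite

/-- A root locus branch of `K * f = ε`, traced from its starting pole to its final zero (either of
which may be the point `∞`): one of the curves of a system of root loci. -/
def IsBranch (f : RatFunc ℝ) (ε : ℝ) (γ : C(I, OnePoint ℂ)) : Prop :=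
  ∃ (n : ℕ) (Γ : Fin n → C(I, OnePoint ℂ)), IsSystem f ε Γ ∧ ∃ i, Γ i = γ

end RootLocus

end

namespace RootLocus

open Polynomial Filter Topology Set unitInterval
open scoped ENNReal

/-! On the locus the gain determines the value of `f`, so the points of the locus with gain `K` form
the fibre of `f` over `ε / K`. For all but finitely many `K` this fibre has exactly `degree f`
points. The proof counts these points against the `n` curves. Near a pole a curve cannot turn back
in gain: at a noncritical point `f` is locally injective, so a local maximum of the gain would make
the curve retrace its own points (`IsSystem.not_isLocalMax_gain`). Hence a small gain occurs once
per curve, each curve covers one point of a small-gain fibre, and `degree f ≤ n`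
(`IsSystem.degree_le`). Conversely, every curve attains every gain by the intermediate value
theorem. A generic gain attained twice on one curve would give `n + 1` distinct points in a fibre of
size at most `degree f ≤ n` (`IsSystem.exists_finite_gain_injective`). So a generic gain occurs once
per curve, which forces monotonicity; strictness holds because fibres are finite. -/

/-! ### Value and gain on the extended plane. -/

theorem aeval_num_ne_zero_or (f : RatFunc ℝ) (s : ℂ) :
    aeval s f.num ≠ 0 ∨ aeval s f.denom ≠ 0 := by
  obtain ⟨a, b, h⟩ := f.isCoprime_num_denom
  by_contra! hc
  have := congrArg (aeval s) h
  simp [hc.1, hc.2] at this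

theorem value_coe (f : RatFunc ℝ) (s : ℂ) :
    value f (s : OnePoint ℂ) = if aeval s f.denom = 0 then OnePoint.infty
      else ((aeval s f.num / aeval s f.denom : ℂ) : OnePoint ℂ) := rfl

theorem value_infty (f : RatFunc ℝ) :
    value f OnePoint.infty = if f.denom.natDegree < f.num.natDegree then OnePoint.infty
      else (((f.num.coeff f.denom.natDegree / f.denom.leadingCoeff : ℝ) : ℂ) : OnePoint ℂ) := rfl

theorem value_coe_eq_iff (f : RatFunc ℝ) (s w : ℂ) :
    value f (s : OnePoint ℂ) = (w : OnePoint ℂ) ↔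
      aeval s f.denom ≠ 0 ∧ aeval s f.num / aeval s f.denom = w := by
  rw [value_coe]
  split_ifs with h
  · simp [h]
  · simp [h]

theorem gain_coe (f : RatFunc ℝ) (s : ℂ) :
    gain f (s : OnePoint ℂ) = ‖aeval s f.denom‖ₑ / ‖aeval s f.num‖ₑ := by
  rw [gain, value_coe]
  split_ifs with h
  · simp [h]
  · change ‖aeval s f.num / aeval s f.denom‖ₑ⁻¹ = _
    rw [div_eq_mul_inv, enorm_mul, enorm_inv h, ← div_eq_mul_inv, ENNReal.inv_div] <;> simp [h]

/-- The degree of a rational function, that is, the number of its poles in the extended plane. -/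
noncomputable def degree (f : RatFunc ℝ) : ℕ := max f.num.natDegree f.denom.natDegree

theorem coeff_degree_ne_zero_or (f : RatFunc ℝ) :
    f.num.coeff (degree f) ≠ 0 ∨ f.denom.coeff (degree f) ≠ 0 := by
  by_cases h : f.denom.natDegree < f.num.natDegree
  · left
    rw [degree, max_eq_left h.le]
    exact leadingCoeff_ne_zero.2 fun h0 => by simp [h0] at h
  · right
    rw [degree, max_eq_right (not_lt.1 h)]
    exact leadingCoeff_ne_zero.2 f.denom_ne_zero

theorem gain_infty (f : RatFunc ℝ) :
    gain f OnePoint.infty =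
      ‖(f.denom.coeff (degree f) : ℂ)‖ₑ / ‖(f.num.coeff (degree f) : ℂ)‖ₑ := by
  rw [gain, value_infty]
  split_ifs with h
  · rw [degree, max_eq_left h.le, coeff_eq_zero_of_natDegree_lt h]
    simp
  · change ‖((f.num.coeff f.denom.natDegree / f.denom.leadingCoeff : ℝ) : ℂ)‖ₑ⁻¹ = _
    have h0 : (f.denom.leadingCoeff : ℂ) ≠ 0 := by simp [f.denom_ne_zero]
    rw [degree, max_eq_right (not_lt.1 h), Complex.ofReal_div, div_eq_mul_inv, enorm_mul,
      enorm_inv h0, ← div_eq_mul_inv, ENNReal.inv_div] <;> simp [f.denom_ne_zero]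

theorem aeval_inv_reflect (p : ℝ[X]) {N : ℕ} (hN : p.natDegree ≤ N) {s : ℂ} (hs : s ≠ 0) :
    aeval s p = aeval s⁻¹ (reflect N p) * s ^ N := by
  let := invertibleOfNonzero hs
  have := eval₂_reflect_mul_pow (algebraMap ℝ ℂ) s N p hN
  rw [aeval_def, aeval_def, ← this, invOf_eq_inv]

theorem aeval_zero_reflect (p : ℝ[X]) (N : ℕ) :
    aeval (0 : ℂ) (reflect N p) = (p.coeff N : ℂ) := by
  rw [← coeff_zero_eq_aeval_zero', coeff_reflect, revAt_zero]
  rfl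

/-- Numerator and denominator never vanish together, so their quotient in `ℝ≥0∞` is continuous. At
`∞` the substitution `u = s⁻¹` turns both into reflected polynomials, which do not both vanish at
`0`. -/
theorem continuous_gain (f : RatFunc ℝ) : Continuous (gain f) := by
  have hc (p : ℝ[X]) (s : ℂ) : Tendsto (fun s : ℂ => ‖aeval s p‖ₑ) (𝓝 s) (𝓝 ‖aeval s p‖ₑ) :=
    (p.continuous_aeval.enorm).tendsto s
  rw [continuous_iff_continuousAt]
  intro z
  induction z using OnePoint.rec with
  | coe s =>
    rw [OnePoint.continuousAt_coe]
    have : gain f ∘ (OnePoint.some : ℂ → OnePoint ℂ) =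
        fun s => ‖aeval s f.denom‖ₑ / ‖aeval s f.num‖ₑ := funext (gain_coe f)
    rw [ContinuousAt, this]
    refine ENNReal.Tendsto.div (hc _ s) ?_ (hc _ s) (Or.inl enorm_ne_top)
    simpa using (aeval_num_ne_zero_or f s).symm
  | infty =>
    rw [OnePoint.continuousAt_infty', coclosedCompact_eq_cocompact, ← Metric.cobounded_eq_cocompact,
      gain_infty, ← aeval_zero_reflect, ← aeval_zero_reflect]
    have h0 : Tendsto (fun u : ℂ => ‖aeval u (reflect (degree f) f.denom)‖ₑ /
        ‖aeval u (reflect (degree f) f.num)‖ₑ) (𝓝 0) (𝓝 (‖aeval (0 : ℂ)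
        (reflect (degree f) f.denom)‖ₑ / ‖aeval (0 : ℂ) (reflect (degree f) f.num)‖ₑ)) := by
      refine ENNReal.Tendsto.div (hc _ 0) ?_ (hc _ 0) (Or.inl enorm_ne_top)
      simpa [aeval_zero_reflect] using (coeff_degree_ne_zero_or f).symm
    refine (h0.comp tendsto_inv₀_cobounded).congr' ?_
    filter_upwards [Bornology.eventually_ne_cobounded (0 : ℂ)] with s hs
    simp only [Function.comp_apply]
    rw [gain_coe, aeval_inv_reflect f.num (le_max_left _ f.denom.natDegree) hs,
      aeval_inv_reflect f.denom (le_max_right f.num.natDegree _) hs, enorm_mul, enorm_mul]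
    exact (ENNReal.mul_div_mul_right _ _ 
      (by simpa using fun h => absurd h hs) enorm_ne_top).symm

theorem gain_eq_zero_iff (f : RatFunc ℝ) (z : OnePoint ℂ) : gain f z = 0 ↔ IsPole f z := by
  rw [gain, IsPole]
  induction value f z using OnePoint.rec <;> simp

theorem gain_eq_top_iff (f : RatFunc ℝ) (z : OnePoint ℂ) : gain f z = ⊤ ↔ IsZero f z := by
  rw [gain, IsZero]
  induction value f z using OnePoint.rec <;> simp

/-! ### Level sets of the gain as fibres of `f`. -/

/-- The points of the locus with gain `k` are the solutions of `f = ε / k`. -/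
theorem mem_locus_and_gain_eq_iff (f : RatFunc ℝ) {ε : ℝ} (hε : ε = 1 ∨ ε = -1) {k : ℝ}
    (hk : 0 < k) (z : OnePoint ℂ) :
    (z ∈ locus f ε ∧ gain f z = ENNReal.ofReal k) ↔
      value f z = ((ε / k : ℂ) : OnePoint ℂ) := by
  have key {K : ℝ} (hK : 0 < K) : ‖(ε / K : ℂ)‖ₑ⁻¹ = ENNReal.ofReal K := by
    have : ‖(ε / K : ℂ)‖ = K⁻¹ := by
      rcases hε with rfl | rfl <;> simp [abs_of_pos hK]
    rw [← ofReal_norm, this, ENNReal.ofReal_inv_of_pos hK, inv_inv]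
  constructor
  · rintro ⟨⟨K, hK, w, hw, h⟩, hg⟩
    have hK' : (K : ℂ) ≠ 0 := by exact_mod_cast hK.ne'
    obtain rfl : w = ε / K := by rw [← h]; field_simp
    rw [gain, hw] at hg
    change ‖(ε / K : ℂ)‖ₑ⁻¹ = _ at hg
    rw [key hK, ENNReal.ofReal_eq_ofReal_iff hK.le hk.le] at hg
    rw [hw, hg]
  · intro h
    refine ⟨⟨k, hk, _, h, ?_⟩, ?_⟩
    · have : (k : ℂ) ≠ 0 := by exact_mod_cast hk.ne'
      field_simp
    · rw [gain, h]
      exact key hk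

theorem exists_gain_eq_of_mem_locus {f : RatFunc ℝ} {ε : ℝ} (hε : ε = 1 ∨ ε = -1)
    {z : OnePoint ℂ} (hz : z ∈ locus f ε) : ∃ k : ℝ, 0 < k ∧ gain f z = ENNReal.ofReal k := by
  obtain ⟨K, hK, w, hw, h⟩ := hz
  have hK' : (K : ℂ) ≠ 0 := by exact_mod_cast hK.ne'
  obtain rfl : w = ε / K := by rw [← h]; field_simp
  exact ⟨K, hK, ((mem_locus_and_gain_eq_iff f hε hK z).2 hw).2⟩

theorem value_eq_of_gain_eq {f : RatFunc ℝ} {ε : ℝ} (hε : ε = 1 ∨ ε = -1) {z z' : OnePoint ℂ}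
    (hz : z ∈ locus f ε) (hz' : z' ∈ locus f ε) (h : gain f z = gain f z') :
    value f z = value f z' := by
  obtain ⟨k, hk, hg⟩ := exists_gain_eq_of_mem_locus hε hz
  rw [(mem_locus_and_gain_eq_iff f hε hk z).1 ⟨hz, hg⟩,
    (mem_locus_and_gain_eq_iff f hε hk z').1 ⟨hz', h ▸ hg⟩]

/-! ### Critical points and the size of fibres. -/

/-- `f` is nonconstant as soon as it has a pole. -/
theorem wronskian_ne_zero {f : RatFunc ℝ} {z : OnePoint ℂ} (hz : IsPole f z) :
    wronskian f.num f.denom ≠ 0 := by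
  intro h
  obtain ⟨h1, h2⟩ := f.isCoprime_num_denom.wronskian_eq_zero_iff.1 h
  have h1 := derivative_eq_zero.1 h1
  have h2 := derivative_eq_zero.1 h2
  obtain ⟨c, hc⟩ := natDegree_eq_zero.1 h2
  have hc0 : c ≠ 0 := fun h0 => f.denom_ne_zero (by rw [← hc, h0, C_0])
  rw [IsPole] at hz
  induction z using OnePoint.rec with
  | coe s =>
    rw [value_coe] at hz
    simp [← hc, hc0] at hz
  | infty =>
    rw [value_infty] at hz
    simp [h1, h2] at hz

/-- Near a noncritical point that is not a pole, `f` is injective. -/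
theorem exists_nhds_injOn_value {f : RatFunc ℝ} {s : ℂ}
    (hs : ¬ IsPole f (s : OnePoint ℂ)) (hW : aeval s (wronskian f.num f.denom) ≠ 0) :
    ∃ U ∈ 𝓝 (s : OnePoint ℂ), InjOn (value f) U := by
  have hQ : aeval s f.denom ≠ 0 := by
    intro h
    apply hs
    rw [IsPole, value_coe, if_pos h]
  have hd := (f.num.hasStrictDerivAt_aeval s).div (f.denom.hasStrictDerivAt_aeval s) hQ
  have hd0 : (aeval s (derivative f.num) * aeval s f.denom -
      aeval s f.num * aeval s (derivative f.denom)) / aeval s f.denom ^ 2 ≠ 0 := by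
    refine div_ne_zero (fun h => hW ?_) (pow_ne_zero 2 hQ)
    rw [wronskian, map_sub, map_mul, map_mul, ← neg_eq_zero, neg_sub]
    exact h
  have h1 := hd.eventually_left_inverse hd0
  have h2 : ∀ᶠ x in 𝓝 s, aeval x f.denom ≠ 0 := f.denom.continuous_aeval.continuousAt.eventually_ne hQ
  refine ⟨_, by rw [OnePoint.nhds_coe_eq]; exact image_mem_map (h1.and h2), ?_⟩
  · rintro _ ⟨x, ⟨hx1, hx2⟩, rfl⟩ _ ⟨y, ⟨hy1, hy2⟩, rfl⟩ hxy
    rw [(value_coe_eq_iff f x _).2 ⟨hx2, rfl⟩, eq_comm, value_coe_eq_iff] at hxy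
    have h3 := hxy.2
    rw [← hx1, ← hy1]
    simp only [Pi.div_apply] at *
    rw [h3]

/-- The polynomial whose roots are the finite solutions of `f = w`. -/
noncomputable def fibrePoly (f : RatFunc ℝ) (w : ℂ) : ℂ[X] :=
  f.num.map (algebraMap ℝ ℂ) - C w * f.denom.map (algebraMap ℝ ℂ)

theorem eval_fibrePoly (f : RatFunc ℝ) (w s : ℂ) :
    (fibrePoly f w).eval s = aeval s f.num - w * aeval s f.denom := by
  simp [fibrePoly, eval_map_algebraMap]

theorem eval_fibrePoly_eq_zero_iff (f : RatFunc ℝ) (w s : ℂ) :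
    (fibrePoly f w).eval s = 0 ↔ value f (s : OnePoint ℂ) = (w : OnePoint ℂ) := by
  rw [eval_fibrePoly, value_coe_eq_iff, sub_eq_zero]
  constructor
  · intro h
    have hQ : aeval s f.denom ≠ 0 := fun h0 => by
      rcases aeval_num_ne_zero_or f s with h1 | h1
      · exact h1 (by rw [h, h0, mul_zero])
      · exact h1 h0
    exact ⟨hQ, by rw [h]; field_simp⟩
  · rintro ⟨hQ, rfl⟩
    field_simp

theorem natDegree_fibrePoly_le (f : RatFunc ℝ) (w : ℂ) :
    (fibrePoly f w).natDegree ≤ degree f := by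
  refine natDegree_sub_le_of_le (natDegree_map_le.trans ?_) ((natDegree_C_mul_le _ _).trans
    (natDegree_map_le.trans ?_)) |>.trans (max_self _).le
  · exact le_max_left _ _
  · exact le_max_right _ _

/-- The degree of `fibrePoly f w` can drop below `degree f` only when `∞` itself is a solution of `f
= w`. -/
theorem coeff_fibrePoly_ne_zero {f : RatFunc ℝ} {w : ℂ}
    (h : value f OnePoint.infty ≠ (w : OnePoint ℂ)) :
    (fibrePoly f w).coeff (degree f) ≠ 0 := by
  intro h0
  apply h
  simp only [fibrePoly, coeff_sub, coeff_map, coeff_C_mul, Complex.coe_algebraMap,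
    sub_eq_zero] at h0
  have hQ : f.denom.coeff (degree f) ≠ 0 := fun h1 => by
    rcases coeff_degree_ne_zero_or f with h2 | h2
    · simp [h1, h2] at h0
    · exact h2 h1
  have hd : degree f = f.denom.natDegree :=
    le_antisymm (le_natDegree_of_ne_zero hQ) (le_max_right _ _)
  have hlt : ¬ f.denom.natDegree < f.num.natDegree := by
    rw [← hd, not_lt]
    exact le_max_left _ _
  rw [value_infty, if_neg hlt, ← coeff_natDegree, ← hd, Complex.ofReal_div, h0,
    mul_div_cancel_right₀ _ (by exact_mod_cast hQ)]

theorem fibrePoly_ne_zero {f : RatFunc ℝ} {z : OnePoint ℂ} (hz : IsPole f z) (w : ℂ) :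
    fibrePoly f w ≠ 0 := by
  intro h
  have : value f z = (w : OnePoint ℂ) := by
    induction z using OnePoint.rec with
    | coe s => rw [← eval_fibrePoly_eq_zero_iff, h, eval_zero]
    | infty =>
      by_contra hne
      exact coeff_fibrePoly_ne_zero hne (by rw [h, coeff_zero])
  rw [hz] at this
  exact OnePoint.infty_ne_coe _ this

theorem finite_fibre {f : RatFunc ℝ} {z : OnePoint ℂ} (hz : IsPole f z) (w : ℂ) :
    {z | value f z = (w : OnePoint ℂ)}.Finite := by
  refine (((fibrePoly f w).roots.toFinset.finite_toSet.image OnePoint.some).insert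
    OnePoint.infty).subset fun x hx => ?_
  induction x using OnePoint.rec with
  | infty => exact mem_insert _ _
  | coe s =>
    refine mem_insert_of_mem _ ⟨s, ?_, rfl⟩
    simpa [fibrePoly_ne_zero hz w, eval_fibrePoly_eq_zero_iff] using hx

/-- The point `∞` together with the finite zeros of the Wronskian of numerator and denominator.
Away from these points `f` is a local homeomorphism of the plane. -/
def exceptionalPoints (f : RatFunc ℝ) : Set (OnePoint ℂ) :=
  insert OnePoint.infty (OnePoint.some '' {s : ℂ | aeval s (wronskian f.num f.denom) = 0})

theorem finite_exceptionalPoints {f : RatFunc ℝ} {z : OnePoint ℂ} (hz : IsPole f z) :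
    (exceptionalPoints f).Finite := by
  refine (Finite.image _ ?_).insert _
  refine ((wronskian f.num f.denom).rootSet_finite ℂ).subset fun s hs => ?_
  exact (mem_rootSet.2 ⟨wronskian_ne_zero hz, hs⟩)

theorem exists_coe_of_notMem_exceptionalPoints {f : RatFunc ℝ} {z : OnePoint ℂ}
    (hz : z ∉ exceptionalPoints f) :
    ∃ s : ℂ, z = s ∧ aeval s (wronskian f.num f.denom) ≠ 0 := by
  induction z using OnePoint.rec with
  | infty => exact absurd (mem_insert _ _) hz
  | coe s => exact ⟨s, rfl, fun h => hz (mem_insert_of_mem _ ⟨s, h, rfl⟩)⟩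

theorem fibre_eq_image_roots {f : RatFunc ℝ} {w : ℂ}
    (h : value f OnePoint.infty ≠ (w : OnePoint ℂ)) :
    {z | value f z = (w : OnePoint ℂ)} =
      OnePoint.some '' ((fibrePoly f w).roots.toFinset : Set ℂ) := by
  have hp : fibrePoly f w ≠ 0 := fun h0 => coeff_fibrePoly_ne_zero h (by rw [h0, coeff_zero])
  ext z
  induction z using OnePoint.rec with
  | infty => simpa using h
  | coe s => simp [hp, eval_fibrePoly_eq_zero_iff]

theorem encard_fibre_le {f : RatFunc ℝ} {w : ℂ}
    (h : value f OnePoint.infty ≠ (w : OnePoint ℂ)) :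
    {z | value f z = (w : OnePoint ℂ)}.encard ≤ degree f := by
  rw [fibre_eq_image_roots h, OnePoint.coe_injective.encard_image, encard_coe_eq_coe_finsetCard]
  exact_mod_cast (Multiset.toFinset_card_le _).trans
    ((card_roots' _).trans (natDegree_fibrePoly_le f w))

/-- A double root of `P - wQ` satisfies `P = wQ` and `P' = wQ'`, hence is a zero of the Wronskian.
Outside the exceptional values all roots are therefore simple. -/
theorem encard_fibre {f : RatFunc ℝ} {w : ℂ}
    (h : ∀ z ∈ exceptionalPoints f, value f z ≠ (w : OnePoint ℂ)) :
    {z | value f z = (w : OnePoint ℂ)}.encard = degree f := by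
  have hi : value f OnePoint.infty ≠ (w : OnePoint ℂ) := h _ (mem_insert _ _)
  have hc := coeff_fibrePoly_ne_zero hi
  have hp : fibrePoly f w ≠ 0 := fun h0 => hc (by rw [h0, coeff_zero])
  have hd : (fibrePoly f w).natDegree = degree f :=
    le_antisymm (natDegree_fibrePoly_le f w) (le_natDegree_of_ne_zero hc)
  have hnd : (fibrePoly f w).roots.Nodup := by
    rw [Multiset.nodup_iff_count_le_one]
    intro s
    rw [count_roots]
    by_contra! hs
    obtain ⟨h1, h2⟩ := (one_lt_rootMultiplicity_iff_isRoot hp).1 hs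
    refine h s (mem_insert_of_mem _ ⟨s, ?_, rfl⟩) ((eval_fibrePoly_eq_zero_iff f w s).1 h1)
    rw [IsRoot, eval_fibrePoly, sub_eq_zero] at h1
    rw [IsRoot, fibrePoly, derivative_sub, derivative_C_mul, derivative_map, derivative_map,
      eval_sub, eval_mul, eval_C, eval_map_algebraMap, eval_map_algebraMap, sub_eq_zero] at h2
    rw [mem_ofPred, wronskian, map_sub, map_mul, map_mul, h1, h2]
    ring
  rw [fibre_eq_image_roots hi, OnePoint.coe_injective.encard_image, encard_coe_eq_coe_finsetCard,
    Multiset.toFinset_card_of_nodup hnd, IsAlgClosed.card_roots_eq_natDegree, hd]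

/-! ### The gain along the curves of a system. -/

namespace IsSystem

variable {f : RatFunc ℝ} {ε : ℝ} {n : ℕ} {Γ : Fin n → C(I, OnePoint ℂ)}

theorem continuous_gain (Γ : Fin n → C(I, OnePoint ℂ)) (i : Fin n) :
    Continuous fun t => gain f (Γ i t) :=
  (RootLocus.continuous_gain f).comp (Γ i).continuous

theorem gain_zero (S : IsSystem f ε Γ) (i : Fin n) : gain f (Γ i 0) = 0 :=
  (gain_eq_zero_iff f _).2 (S.start_pole i)

theorem gain_one (S : IsSystem f ε Γ) (i : Fin n) : gain f (Γ i 1) = ⊤ :=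
  (gain_eq_top_iff f _).2 (S.end_zero i)

theorem gain_pos (S : IsSystem f ε Γ) (hε : ε = 1 ∨ ε = -1) (i : Fin n) {t : I} (ht : 0 < t) :
    0 < gain f (Γ i t) := by
  rcases unitInterval.le_one'.lt_or_eq (a := t) with h1 | rfl
  · obtain ⟨k, hk, h⟩ := exists_gain_eq_of_mem_locus hε (S.mem_locus i t ht h1)
    rw [h]
    exact ENNReal.ofReal_pos.2 hk
  · simp [S.gain_one i]

theorem mem_locus_of_gain (S : IsSystem f ε Γ) {i : Fin n} {t : I} (h0 : gain f (Γ i t) ≠ 0)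
    (h1 : gain f (Γ i t) ≠ ⊤) : Γ i t ∈ locus f ε := by
  refine S.mem_locus i t (unitInterval.pos_iff_ne_zero.2 ?_) (unitInterval.lt_one_iff_ne_one.2 ?_)
  · rintro rfl
    exact h0 (S.gain_zero i)
  · rintro rfl
    exact h1 (S.gain_one i)

/-- Near `t`, equal gains mean equal values of `f`, hence equal points, hence an overlap. Since
overlaps are finite in number, the gain is injective near `t`, so strictly monotone there. -/
theorem not_isLocalMax_gain (S : IsSystem f ε Γ) (hε : ε = 1 ∨ ε = -1) (i : Fin n) {t : I}
    (h0 : 0 < t) (h1 : t < 1) (ht : Γ i t ∉ exceptionalPoints f) :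
    ¬ IsLocalMax (fun t => gain f (Γ i t)) t := by
  intro hmax
  obtain ⟨s, hs, hW⟩ := exists_coe_of_notMem_exceptionalPoints ht
  have hpole : ¬ IsPole f (s : OnePoint ℂ) := by
    rw [← gain_eq_zero_iff, ← hs]
    exact (S.gain_pos hε i h0).ne'
  obtain ⟨U, hU, hinj⟩ := exists_nhds_injOn_value hpole hW
  rw [← hs] at hU
  have hV1 : ∀ᶠ x in 𝓝 t, Γ i x ∈ U := (Γ i).continuous.continuousAt hU
  -- The time `t` may itself be a crossing, so it is not excluded. Of two distinct times at least
  -- one differs from `t`, which suffices.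
  have hF := (S.no_overlap.image fun x => x.1.2).subset (sdiff_subset (t := {t}))
  have hV2 : ∀ᶠ x in 𝓝 t, x ∉ _ := hF.isClosed.isOpen_compl.mem_nhds fun h => h.2 rfl
  have hV3 : ∀ᶠ x in 𝓝 t, x ∈ Ioo (0 : I) 1 := Ioo_mem_nhds h0 h1
  obtain ⟨l, u, ⟨hlt, htu⟩, hsub⟩ := (mem_nhds_iff_exists_Ioo_subset' ⟨0, h0⟩ ⟨1, h1⟩).1
    (((hV1.and hV2).and hV3).and hmax)
  obtain ⟨a, hla, hat⟩ := exists_between hlt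
  obtain ⟨b, htb, hbu⟩ := exists_between htu
  have hab : Icc a b ⊆ Ioo l u := Icc_subset_Ioo hla hbu
  have haI : a ∈ Icc a b := left_mem_Icc.2 (hat.trans htb).le
  have hbI : b ∈ Icc a b := right_mem_Icc.2 (hat.trans htb).le
  have htI : t ∈ Icc a b := ⟨hat.le, htb.le⟩
  have hinjOn : InjOn (fun t => gain f (Γ i t)) (Icc a b) := by
    intro x hx y hy hxy
    obtain ⟨⟨⟨hx1, hx2⟩, hx3⟩, -⟩ := hsub (hab hx)
    obtain ⟨⟨⟨hy1, hy2⟩, hy3⟩, -⟩ := hsub (hab hy)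
    have hlx := S.mem_locus i x hx3.1 hx3.2
    have hly := S.mem_locus i y hy3.1 hy3.2
    have hΓ : Γ i x = Γ i y := hinj hx1 hy1 (value_eq_of_gain_eq hε hlx hly hxy)
    by_contra hne
    have hxt : x = t := by
      by_contra h
      exact hx2 ⟨⟨((i, x), (i, y)), ⟨by simpa using hne, hΓ, hlx⟩, rfl⟩, h⟩
    have hyt : y = t := by
      by_contra h
      exact hy2 ⟨⟨((i, y), (i, x)), ⟨by simpa using Ne.symm hne, hΓ.symm, hly⟩, rfl⟩, h⟩
    exact hne (hxt.trans hyt.symm)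
  rcases (continuous_gain (f := f) Γ i).continuousOn.strictMonoOn_of_injOn_Icc' (hat.trans htb).le
    hinjOn with hm | hm
  · exact (hm htI hbI htb).not_ge (hsub (hab hbI)).2
  · exact (hm haI htI hat).not_ge (hsub (hab haI)).2

/-- Sufficiently small gains are attained only once along each curve. -/
theorem eventually_gain_injective (S : IsSystem f ε Γ) (hε : ε = 1 ∨ ε = -1) :
    ∀ᶠ K in 𝓝[>] (0 : ℝ≥0∞), ∀ i t u, gain f (Γ i t) = K → gain f (Γ i u) = K → t = u := by
  rw [eventually_all]
  intro i
  have hc := continuous_gain (f := f) Γ i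
  -- Below every positive gain of an exceptional point, the only exceptional points left are poles.
  have hB : ∀ᶠ K in 𝓝 (0 : ℝ≥0∞), ∀ z ∈ exceptionalPoints f, 0 < gain f z → K < gain f z := by
    rw [eventually_all_finite (finite_exceptionalPoints (S.start_pole i))]
    intro z _
    by_cases hz : 0 < gain f z
    · filter_upwards [Iio_mem_nhds hz] with K hK _ using hK
    · exact Eventually.of_forall fun K h => absurd h hz
  have hlim : Tendsto (fun t => gain f (Γ i t)) (𝓝 0) (𝓝 0) := by
    simpa only [S.gain_zero] using hc.tendsto 0
  have hB := hlim.eventually hB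
  obtain ⟨v, hv, hsub⟩ := exists_Ico_subset_of_mem_nhds hB ⟨1, zero_lt_one⟩
  -- A gain below the minimum over `[v, 1]` can only be attained before time `v`.
  obtain ⟨c, hcm, hmin⟩ := (isCompact_Icc (a := v) (b := 1)).exists_isMinOn
    ⟨1, unitInterval.le_one', le_rfl⟩ hc.continuousOn
  have hpos := S.gain_pos hε i (hv.trans_le hcm.1)
  filter_upwards [self_mem_nhdsWithin, nhdsWithin_le_nhds (Iio_mem_nhds hpos)] with K hK0 hKm
  have main {t u : I} (htu : t < u) (ht : gain f (Γ i t) = K) (hu : gain f (Γ i u) = K) :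
      False := by
    have huv : u < v := by
      by_contra! h
      have hcu : gain f (Γ i c) ≤ gain f (Γ i u) := hmin ⟨h, unitInterval.le_one'⟩
      exact (hcu.trans_eq hu).not_gt hKm
    have ht0 : 0 < t := unitInterval.pos_iff_ne_zero.2 fun h => by
      rw [h, S.gain_zero] at ht
      exact hK0.ne ht
    obtain ⟨x, hx0, hxu, hx⟩ : ∃ x, 0 < x ∧ x < u ∧
        IsMaxOn (fun t => gain f (Γ i t)) (Icc 0 u) x := by
      obtain ⟨x, hxm, hx⟩ := (isCompact_Icc (a := 0) (b := u)).exists_isMaxOn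
        ⟨0, le_rfl, unitInterval.nonneg'⟩ hc.continuousOn
      rcases hxm.2.lt_or_eq with h | rfl
      · refine ⟨x, unitInterval.pos_iff_ne_zero.2 ?_, h, hx⟩
        rintro rfl
        have := hx (show t ∈ Icc 0 u from ⟨ht0.le, htu.le⟩)
        simp only [mem_ofPred, ht, S.gain_zero] at this
        exact hK0.not_ge this
      -- A maximum at the endpoint `u` is also attained at the interior time `t`, both gains being
      -- `K`.
      · refine ⟨t, ht0, htu, fun y hy => ?_⟩
        have := hx hy
        simp only [mem_ofPred, ht, hu] at this ⊢
        exact this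
    refine S.not_isLocalMax_gain hε i hx0 (hxu.trans_le unitInterval.le_one') (fun hE => ?_)
      (hx.isLocalMax (Icc_mem_nhds hx0 hxu))
    exact (hsub ⟨hx0.le, hxu.trans huv⟩ _ hE (S.gain_pos hε i hx0)).false
  intro t u ht hu
  rcases lt_trichotomy t u with h | h | h
  · exact (main h ht hu).elim
  · exact h
  · exact (main h hu ht).elim

theorem mem_locus_and_gain_eq_iff_value (hε : ε = 1 ∨ ε = -1) {K : ℝ≥0∞} (h0 : K ≠ 0)
    (h1 : K ≠ ⊤) (z : OnePoint ℂ) :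
    (z ∈ locus f ε ∧ gain f z = K) ↔ value f z = ((ε / K.toReal : ℂ) : OnePoint ℂ) := by
  rw [← mem_locus_and_gain_eq_iff f hε (ENNReal.toReal_pos h0 h1), ENNReal.ofReal_toReal h1]

/-! ### Counting curves against fibre points. -/

/-- There are at least as many curves as poles, counted with multiplicity. -/
theorem degree_le (S : IsSystem f ε Γ) (hε : ε = 1 ∨ ε = -1) (i : Fin n) : degree f ≤ n := by
  obtain ⟨d, hd, hsub⟩ := (mem_nhdsGT_iff_exists_Ioo_subset' ENNReal.zero_lt_top).1 (S.eventually_gain_injective hε)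
  obtain ⟨K, hK, hKE⟩ := ((Ioo_infinite hd).sdiff
    ((finite_exceptionalPoints (S.start_pole i)).image (gain f))).nonempty
  have hinj := hsub hK
  have hiff := mem_locus_and_gain_eq_iff_value (f := f) hε hK.1.ne' hK.2.ne_top
  have hcard := encard_fibre (f := f) (w := ε / K.toReal) fun z hz hv =>
    hKE ⟨z, hz, ((hiff z).2 hv).2⟩
  have hex : ∀ z, ∃ j : Fin n, value f z = ((ε / K.toReal : ℂ) : OnePoint ℂ) →
      ∃ t, Γ j t = z := by
    intro z
    by_cases hz : value f z = ((ε / K.toReal : ℂ) : OnePoint ℂ)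
    · obtain ⟨j, t, h⟩ := S.covers z ((hiff z).2 hz).1
      exact ⟨j, fun _ => ⟨t, h⟩⟩
    · exact ⟨i, fun h => absurd h hz⟩
  choose g hg using hex
  -- Two fibre points on one curve would give two times with the same small gain `K`, so choosing a
  -- curve through each point is injective.
  have hle := encard_le_encard_of_injOn (mapsTo_univ g {z | value f z =
      ((ε / K.toReal : ℂ) : OnePoint ℂ)}) (by
    intro x hx y hy hxy
    obtain ⟨t, ht⟩ := hg x hx
    obtain ⟨u, hu⟩ := hg y hy
    rw [← hxy] at hu
    have htu := hinj (g x) t u ((congrArg (gain f) ht).trans ((hiff x).2 hx).2)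
      ((congrArg (gain f) hu).trans ((hiff y).2 hy).2)
    rw [← ht, ← hu, htu])
  rw [hcard, encard_univ, ENat.card_eq_coe_fintype_card, Fintype.card_fin] at hle
  exact_mod_cast hle

theorem exists_gain_eq (S : IsSystem f ε Γ) (i : Fin n) (K : ℝ≥0∞) : ∃ t, gain f (Γ i t) = K := by
  obtain ⟨t, -, ht⟩ := intermediate_value_Icc (zero_le_one (α := I))
    (continuous_gain (f := f) Γ i).continuousOn
    (show K ∈ Icc _ _ from ⟨by simp [S.gain_zero], by simp [S.gain_one]⟩)
  exact ⟨t, ht⟩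

/-- All but finitely many gains are attained only once along each curve. -/
theorem exists_finite_gain_injective (S : IsSystem f ε Γ) (hε : ε = 1 ∨ ε = -1) :
    ∃ B : Set ℝ≥0∞, B.Finite ∧ ∀ K ∉ B, ∀ i t u, gain f (Γ i t) = K → gain f (Γ i u) = K →
      t = u := by
  -- Besides `0` and `⊤`, the excluded gains are those at `∞`, where the root count could miss a
  -- solution, and those at crossings.
  refine ⟨{0, ⊤, gain f OnePoint.infty} ∪ (fun x => gain f (Γ x.1.1 x.1.2)) '' _,
    (toFinite _).union (S.no_overlap.image _), fun K hK i t u ht hu => ?_⟩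
  simp only [mem_union, mem_insert_iff, mem_singleton_iff, not_or] at hK
  obtain ⟨⟨hK0, hK1, hKi⟩, hKo⟩ := hK
  by_contra htu
  have hiff := mem_locus_and_gain_eq_iff_value (f := f) hε hK0 hK1
  have hlocus {j : Fin n} {x : I} (h : gain f (Γ j x) = K) : Γ j x ∈ locus f ε :=
    S.mem_locus_of_gain (h ▸ hK0) (h ▸ hK1)
  have hcard := encard_fibre_le (f := f) (w := ε / K.toReal) fun hv =>
    hKi ((hiff _).2 hv).2.symm
  choose τ hτ using fun j => S.exists_gain_eq j K
  obtain ⟨x, hx, hxτ⟩ : ∃ x, gain f (Γ i x) = K ∧ x ≠ τ i := by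
    by_cases h : t = τ i
    · exact ⟨u, hu, fun h' => htu (h.trans h'.symm)⟩
    · exact ⟨t, ht, h⟩
  -- These are `n + 1` parameters of gain `K`: one on each curve and a second one on curve `i`.
  let g : Option (Fin n) → Fin n × I := fun o => o.elim (i, x) fun j => (j, τ j)
  have hg : ∀ o, gain f (Γ (g o).1 (g o).2) = K := by
    rintro (_ | j)
    · exact hx
    · exact hτ j
  have hgi : Function.Injective g := by
    rintro (_ | j) (_ | k) h
    · rfl
    · obtain ⟨rfl, h⟩ := Prod.mk.inj h
      exact absurd h hxτ
    · obtain ⟨rfl, hx'⟩ := Prod.mk.inj h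
      exact absurd hx'.symm hxτ
    · rw [(Prod.mk.inj h).1]
  have hle := encard_le_encard_of_injOn (s := univ)
    (t := {z | value f z = ((ε / K.toReal : ℂ) : OnePoint ℂ)})
    (f := fun o => Γ (g o).1 (g o).2) (fun o _ => (hiff _).1 ⟨hlocus (hg o), hg o⟩) (by
      intro o _ o' _ h
      by_contra hne
      exact hKo ⟨(g o, g o'), ⟨hgi.ne hne, h, hlocus (hg o)⟩, hg o⟩)
  have := hle.trans (hcard.trans (Nat.cast_le.2 (S.degree_le hε i)))
  rw [encard_univ, ENat.card_eq_coe_fintype_card, Fintype.card_option, Fintype.card_fin] at this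
  exact absurd (Nat.cast_le.1 this) (by simp)

/-! ### Monotonicity and strictness. -/

/-- After a drop in gain the curve must climb again to `⊤`, so a whole interval of gains would be
attained twice, including a generic one. -/
theorem monotone_gain (S : IsSystem f ε Γ) (hε : ε = 1 ∨ ε = -1) (i : Fin n) :
    Monotone fun t => gain f (Γ i t) := by
  obtain ⟨B, hB, hinj⟩ := S.exists_finite_gain_injective hε
  have hc := continuous_gain (f := f) Γ i
  intro t u htu
  by_contra! hlt
  obtain ⟨K, hK, hKB⟩ := ((Ioo_infinite hlt).sdiff hB).nonempty
  obtain ⟨x, hx, hxK⟩ := intermediate_value_Icc' htu hc.continuousOn (Ioo_subset_Icc_self hK)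
  obtain ⟨y, hy, hyK⟩ := intermediate_value_Icc (unitInterval.le_one' (t := u)) hc.continuousOn
    (show K ∈ Icc _ _ from ⟨hK.1.le, by simp [S.gain_one]⟩)
  have hxy := hinj K hKB i x y hxK hyK
  obtain rfl : x = u := le_antisymm hx.2 (hxy ▸ hy.1)
  exact hK.1.ne hxK

theorem strictMono_gain (S : IsSystem f ε Γ) (hε : ε = 1 ∨ ε = -1) (i : Fin n) :
    StrictMono fun t => gain f (Γ i t) := by
  refine (S.monotone_gain hε i).strictMono_of_injective ?_
  have main {t u : I} (htu : t < u) (h : gain f (Γ i t) = gain f (Γ i u)) : False := by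
    obtain ⟨K, hK⟩ : ∃ K, gain f (Γ i u) = K := ⟨_, rfl⟩
    have hconst : ∀ x ∈ Ioo t u, Γ i x ∈ locus f ε ∧ gain f (Γ i x) = K := fun x hx =>
      ⟨S.mem_locus i x (unitInterval.nonneg'.trans_lt hx.1) (hx.2.trans_le unitInterval.le_one'),
        le_antisymm (hK ▸ S.monotone_gain hε i hx.2.le)
          (hK ▸ h ▸ S.monotone_gain hε i hx.1.le)⟩
    obtain ⟨m, hm⟩ := exists_between htu
    obtain ⟨k, hk, hgk⟩ := exists_gain_eq_of_mem_locus hε (hconst m hm).1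
    obtain rfl : ENNReal.ofReal k = K := hgk.symm.trans (hconst m hm).2
    have hmaps : MapsTo (Γ i) (Ioo t u) {z | value f z = ((ε / k : ℂ) : OnePoint ℂ)} :=
      fun x hx => (mem_locus_and_gain_eq_iff f hε hk _).1 (hconst x hx)
    -- A constant gain on an interval sends infinitely many times into one finite fibre. By
    -- pigeonhole two non-overlap times share a point.
    have hfin := (S.no_overlap.image fun x => x.1.2)
    obtain ⟨x, hx, y, hy, hxy, hΓ⟩ := ((Ioo_infinite htu).sdiff hfin).exists_ne_map_eq_of_mapsTo
      (hmaps.mono_left sdiff_subset) (finite_fibre (S.start_pole i) _)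
    exact hx.2 ⟨((i, x), (i, y)), ⟨by simpa using hxy, hΓ, (hconst x hx.1).1⟩, rfl⟩
  intro t u h
  rcases lt_trichotomy t u with htu | htu | htu
  · exact (main htu h).elim
  · exact htu
  · exact (main htu h.symm).elim

end IsSystem

end RootLocus

theorem theorem2p8 (f : RatFunc ℝ) (ε : ℝ) (hε : ε = 1 ∨ ε = -1)
    (γ : C(unitInterval, OnePoint ℂ)) (hγ : RootLocus.IsBranch f ε γ) :
    StrictMono (fun t : unitInterval => RootLocus.gain f (γ t)) := by
  obtain ⟨n, Γ, S, i, rfl⟩ := hγ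
  exact S.strictMono_gain hε i
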